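/- Let $a,b\in\mathbb R$ and let $m\ge 1$ and $n\ge 2$ be integers. Consider the generalized Fibonacci substitution $S(a)=a^m b^n$, $S(b)=a$ on the alphabet $\{a,b\}$ (if $a=b$, the two letters are still treated as distinct symbols). Let $u$ be the one-sided infinite word $\lim_{k\to\infty}S^k(a)$, and let $\Omega$ be the associated subshift, that is, the set of all two-sided sequences $\omega=(\omega_j)_{j\in\mathbb Z}$ over the alphabet all of whose finite subwords occur in $u$. For $\omega\in\Omega$ let $V_\omega(j)=\omega_j$ for $j\in\mathbb Z$, and let $H_\omega$ be the operator on $\ell^2(\mathbb Z)$ given by $$(H_\omega\psi)(j)=\psi(j-1)+\psi(j+1)+V_\omega(j)\psi(j).$$ For $p>0$ and $T>0$ put $$\langle|X|^p_{\delta_1}\rangle(T)=\sum_{j\in\mathbb Z}|j|^p\,\frac1T\int_0^\infty e^{-2t/T}\,\bigl|\langle\delta_j,e^{-itH_\omega}\delta_1\rangle\bigr|^2\,dt,\qquad \beta^-_{\delta_1}(p)=\liminf_{T\to\infty}\frac{\log\,\langle|X|^p_{\delta_1}\rangle(T)}{\log T},$$ and for $x,E\in\mathbb R$ let $T(x,E)=\begin{pmatrix}E-x&-1\\1&0\end{pmatrix}$.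 (a) If $n\ge2$ is even, then for every $\omega\in\Omega$ the operator $H_\omega$ satisfies: if $|a-b|<2$, then $\beta^-_{\delta_1}(p)\ge p-1$ for every $p>0$; if $|a-b|=2$, then $\beta^-_{\delta_1}(p)\ge\frac{p-5}{2}$ for every $p>0$. (b) If $n\ge3$ is odd, then there are exactly $n-1$ real numbers $E_0$ with $T(b,E_0)^n=I$ or $T(b,E_0)^n=-I$, and for each such $E_0$ and every $\omega\in\Omega$ the operator $H_\omega$ satisfies: if $|a-E_0|<2$, then $\beta^-_{\delta_1}(p)\ge p-1$ for every $p>0$; if $|a-E_0|=2$, then $\beta^-_{\delta_1}(p)\ge\frac{p-5}{2}$ for every $p>0$. -/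

import Mathlib

open scoped ENNReal

namespace GenFib

/-! ### Discrete Schrödinger operators on `ℓ²(ℤ)` -/

/-- The Hilbert space `ℓ²(ℤ)` of square-summable complex sequences. -/
abbrev ELL2 : Type := lp (fun _ : ℤ => ℂ) 2

theorem memlp_shift (k : ℤ) (ψ : ELL2) :
    Memℓp (fun n : ℤ => (ψ : ℤ → ℂ) (n + k)) 2 := by
  have h := (lp.memℓp ψ).summable (by norm_num)
  exact memℓp_gen ((Equiv.addRight k).summable_iff.mpr h)

/-- The translation `(S_k ψ)(n) = ψ(n + k)` on `ℓ²(ℤ)`. -/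
noncomputable def shift (k : ℤ) : ELL2 →L[ℂ] ELL2 :=
  LinearMap.mkContinuous
    { toFun := fun ψ => (⟨fun n : ℤ => (ψ : ℤ → ℂ) (n + k), memlp_shift k ψ⟩ : ELL2)
      map_add' := fun _ _ => rfl
      map_smul' := fun _ _ => rfl } 1 (by
    intro ψ
    rw [one_mul]
    refine lp.norm_le_of_tsum_le (by norm_num) (norm_nonneg _) ?_
    rw [lp.norm_rpow_eq_tsum (by norm_num) ψ]
    exact ((Equiv.addRight k).tsum_eq
      (fun n : ℤ => ‖(ψ : ℤ → ℂ) n‖ ^ (2 : ℝ≥0∞).toReal)).le)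

theorem norm_mul_rpow_le {C : ℝ} {v : ℝ} (hv : |v| ≤ C) (z : ℂ) :
    ‖(v : ℂ) * z‖ ^ (2 : ℝ≥0∞).toReal ≤ C ^ 2 * ‖z‖ ^ (2 : ℝ≥0∞).toReal := by
  have h2 : (2 : ℝ≥0∞).toReal = ((2 : ℕ) : ℝ) := by norm_num
  rw [h2, Real.rpow_natCast, Real.rpow_natCast, norm_mul, mul_pow, Complex.norm_real,
    Real.norm_eq_abs]
  gcongr

theorem memlp_mul {V : ℤ → ℝ} {C : ℝ} (hC : ∀ n, |V n| ≤ C) (ψ : ELL2) :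
    Memℓp (fun n : ℤ => (V n : ℂ) * (ψ : ℤ → ℂ) n) 2 := by
  have h := (lp.memℓp ψ).summable (by norm_num)
  refine memℓp_gen (Summable.of_nonneg_of_le (fun n => by positivity)
    (fun n => norm_mul_rpow_le (hC n) _) (h.mul_left (C ^ 2)))

/-- Multiplication by a bounded real potential, `(V ψ)(n) = V(n) ψ(n)`, on `ℓ²(ℤ)`. -/
noncomputable def mulPotential (V : ℤ → ℝ) (hV : ∃ C : ℝ, ∀ n, |V n| ≤ C) : ELL2 →L[ℂ] ELL2 :=
  LinearMap.mkContinuousOfExistsBound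
    { toFun := fun ψ => (⟨fun n : ℤ => (V n : ℂ) * (ψ : ℤ → ℂ) n,
        memlp_mul hV.choose_spec ψ⟩ : ELL2)
      map_add' := fun ψ φ => lp.ext (funext fun n => mul_add _ _ _)
      map_smul' := fun c ψ => lp.ext (funext fun n => mul_left_comm _ _ _) } (by
    obtain ⟨C, hC⟩ := hV
    have hC0 : 0 ≤ C := (abs_nonneg _).trans (hC 0)
    refine ⟨C, fun ψ => ?_⟩
    have h := (lp.memℓp ψ).summable (by norm_num)
    have h2 : (2 : ℝ≥0∞).toReal = ((2 : ℕ) : ℝ) := by norm_num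
    refine lp.norm_le_of_tsum_le (by norm_num) (by positivity) ?_
    rw [Real.mul_rpow hC0 (norm_nonneg _), lp.norm_rpow_eq_tsum (by norm_num) ψ, ← tsum_mul_left]
    have hle : ∀ n : ℤ, ‖(V n : ℂ) * (ψ : ℤ → ℂ) n‖ ^ (2 : ℝ≥0∞).toReal
        ≤ C ^ (2 : ℝ≥0∞).toReal * ‖(ψ : ℤ → ℂ) n‖ ^ (2 : ℝ≥0∞).toReal := by
      intro n
      refine (norm_mul_rpow_le (hC n) _).trans_eq ?_
      rw [h2, Real.rpow_natCast C 2]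
    exact Summable.tsum_le_tsum hle
      (Summable.of_nonneg_of_le (fun n => by positivity) hle (h.mul_left _)) (h.mul_left _))

/-- The discrete Schrödinger operator `H` on `ℓ²(ℤ)` with bounded real potential `V`. -/
noncomputable def schrodinger (V : ℤ → ℝ) (hV : ∃ C : ℝ, ∀ n, |V n| ≤ C) : ELL2 →L[ℂ] ELL2 :=
  shift (-1) + shift 1 + mulPotential V hV

/-- `(H ψ)(n) = ψ(n - 1) + ψ(n + 1) + V(n) ψ(n)`. -/
theorem schrodinger_apply (V : ℤ → ℝ) (hV : ∃ C : ℝ, ∀ n, |V n| ≤ C) (ψ : ELL2) (n : ℤ) :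
    (schrodinger V hV ψ : ℤ → ℂ) n
      = (ψ : ℤ → ℂ) (n - 1) + (ψ : ℤ → ℂ) (n + 1) + (V n : ℂ) * (ψ : ℤ → ℂ) n := rfl

/-! ### Quantum dynamics -/

/-- The unit vector `δ_n` of `ℓ²(ℤ)`. -/
noncomputable def delta (n : ℤ) : ELL2 := lp.single 2 n (1 : ℂ)

/-- The time evolution `exp(-i t H)` of a bounded operator `H`. -/
noncomputable def evolution (H : ELL2 →L[ℂ] ELL2) (t : ℝ) : ELL2 →L[ℂ] ELL2 :=
  NormedSpace.exp ((-(Complex.I * (t : ℂ))) • H)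

/-- The time-averaged probability
`a(n, T) = (1 / T) ∫₀^∞ e^{-2t/T} |⟨δ_n, exp(-itH) ψ⟩|² dt`. -/
noncomputable def avgProb (H : ELL2 →L[ℂ] ELL2) (ψ : ELL2) (n : ℤ) (T : ℝ) : ℝ≥0∞ :=
  ENNReal.ofReal (1 / T) *
    ∫⁻ t in Set.Ioi (0 : ℝ),
      ENNReal.ofReal (Real.exp (-2 * t / T) * ‖inner ℂ (delta n) (evolution H t ψ)‖ ^ 2)

/-- The time-averaged moment `⟨|X|_ψ^p⟩(T) = ∑_n |n|^p a(n, T)`. -/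
noncomputable def moment (H : ELL2 →L[ℂ] ELL2) (ψ : ELL2) (p T : ℝ) : ℝ≥0∞ :=
  ∑' n : ℤ, ENNReal.ofReal (|(n : ℝ)| ^ p) * avgProb H ψ n T

/-- The lower growth exponent
`β⁻_ψ(p) = liminf_{T → ∞} log ⟨|X|_ψ^p⟩(T) / log T`, as an extended real number. -/
noncomputable def betaMinus (H : ELL2 →L[ℂ] ELL2) (ψ : ELL2) (p : ℝ) : EReal :=
  Filter.liminf (fun T : ℝ => ENNReal.log (moment H ψ p T) / ((Real.log T : ℝ) : EReal))
    Filter.atTop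

/-! ### Substitutions and their subshifts -/

/-- The two symbols of the alphabet. -/
inductive Letter : Type
  | a
  | b

/-- The generalized Fibonacci substitution `S(a) = a^m b^n`, `S(b) = a`. -/
def genFib (m n : ℕ) : Letter → List Letter
  | Letter.a => List.replicate m Letter.a ++ List.replicate n Letter.b
  | Letter.b => [Letter.a]

/-- The extension of a substitution to finite words, by concatenation. -/
def substWord (S : Letter → List Letter) (w : List Letter) : List Letter := w.flatMap S

/-- The one-sided sequence obtained by iterating `S` on the letter `a`. For the substitutions
`genFib m n` with `m, n ≥ 1` each word `S^k(a)` is a prefix of `S^(k+1)(a)` and has length at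
least `k + 1`; the `i`-th symbol of the limit sequence (counting from `0`) is therefore the `i`-th
symbol of `S^i(a)`, and the default value of `getD` is not used. -/
def substSeq (S : Letter → List Letter) (i : ℕ) : Letter :=
  ((substWord S)^[i] [Letter.a]).getD i Letter.a

/-- The two-sided subshift associated with `S`: all `ω : ℤ → {a, b}` all of whose finite
subwords `ω_i ω_{i+1} … ω_{i+l-1}` occur in the sequence `substSeq S`. -/
def subshift (S : Letter → List Letter) : Set (ℤ → Letter) :=
  {ω | ∀ (i : ℤ) (l : ℕ), ∃ j : ℕ, ∀ k : ℕ, k < l → ω (i + (k : ℤ)) = substSeq S (j + k)}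

/-- The real numbers `a`, `b` that the two symbols stand for. -/
def letterVal (a b : ℝ) : Letter → ℝ
  | Letter.a => a
  | Letter.b => b

/-- The potential `V_ω(n) = ω_n`. -/
def potential (a b : ℝ) (ω : ℤ → Letter) (n : ℤ) : ℝ := letterVal a b (ω n)

theorem potential_bounded (a b : ℝ) (ω : ℤ → Letter) :
    ∃ C : ℝ, ∀ n, |potential a b ω n| ≤ C := by
  refine ⟨max |a| |b|, fun n => ?_⟩
  unfold potential
  cases ω n
  · exact le_max_left _ _
  · exact le_max_right _ _

/-- The Schrödinger operator on `ℓ²(ℤ)` with potential `V_ω`. -/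
noncomputable def hamiltonian (a b : ℝ) (ω : ℤ → Letter) : ELL2 →L[ℂ] ELL2 :=
  schrodinger (potential a b ω) (potential_bounded a b ω)

/-! ### Transfer matrices -/

/-- The one-step transfer matrix `T(x, E)`. -/
def transfer (x E : ℝ) : Matrix (Fin 2) (Fin 2) ℝ := !![E - x, -1; 1, 0]

end GenFib

open GenFib

/-! At an energy `E` with `T(b,E)^n = ±I` the block `b^n` is invisible up to sign. Every finite word
of the subshift is a factor of a concatenation of the blocks `a^m b^n` and `a`, so its transfer
matrix is `± B^r A^d B^(-r')` with `A = T(a,E)`, `B = T(b,E)`, `r, r' ≤ n` and `d` at most the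
length `L` (`wordProd_take_drop_substWord`). Growth is thus that of the powers of `A`: bounded for
`|a - E| < 2`, linear for `|a - E| = 2`. This gives a bound `C (L+1)^α` with `α = 0` or `1`, uniform
in the position of the word.

Such a bound at a single energy yields the transport exponent `(p - 1 - 4α)/(1 + α)`
(`betaMinus_ge_of_transfer_power_law`). The Laplace transform `G` of the amplitude solves the
eigenvalue equation at `E + iη`, `η = 2/T`, with a source at site 1. The imaginary part changes
transfer matrices only by a bounded factor up to distance `N ~ T^(1/(1+α))`, so on one half-line `G`
is at least of order `N^(-α)`. By Cauchy–Schwarz in time the averaged probability at `n` is at least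
`2|G(n)|²/T²`; summing over `|n|` of order `N` gives a moment of order `N^(p+1-2α)/T²`.

The suitable energies are the zeros of the Chebyshev polynomial `U_(n-1)((E-b)/2)`. For even `n` one
of them is `E = b`, since `T(b,b)² = -I`. -/

namespace GenFib

/-! ### Ordered products along words and windows of two-sided sequences -/

section Words

variable {α M : Type*} [Monoid M]

/-- The ordered product of the letters of a word, the first letter acting first. -/
def wordProd (A : α → M) : List α → M
  | [] => 1
  | x :: w => wordProd A w * A x

@[simp] theorem wordProd_nil (A : α → M) : wordProd A [] = 1 := rfl

@[simp] theorem wordProd_cons (A : α → M) (x : α) (w : List α) :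
    wordProd A (x :: w) = wordProd A w * A x := rfl

theorem wordProd_append (A : α → M) (v w : List α) :
    wordProd A (v ++ w) = wordProd A w * wordProd A v := by
  induction v with
  | nil => simp
  | cons x v ih => simp [ih, mul_assoc]

theorem wordProd_replicate (A : α → M) (x : α) (k : ℕ) :
    wordProd A (List.replicate k x) = A x ^ k := by
  induction k with
  | zero => simp
  | succ k ih => simp [List.replicate_succ, ih, pow_succ]

theorem wordProd_map {β : Type*} (A : α → M) (f : β → α) (w : List β) :
    wordProd A (w.map f) = wordProd (fun x => A (f x)) w := by
  induction w with
  | nil => rfl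
  | cons x w ih => simp [ih]

/-- The finite subword `f i, f (i + 1), …, f (i + L - 1)` of a two-sided sequence. -/
def window (f : ℤ → α) : ℤ → ℕ → List α
  | _, 0 => []
  | i, L + 1 => f i :: window f (i + 1) L

theorem window_succ (f : ℤ → α) (i : ℤ) (L : ℕ) :
    window f i (L + 1) = window f i L ++ [f (i + L)] := by
  induction L generalizing i with
  | zero => simp [window]
  | succ L ih =>
    rw [window, ih]
    simp only [window, List.cons_append]
    congr 4
    push_cast
    ring

theorem window_neg (f : ℤ → α) (i : ℤ) (L : ℕ) :
    window (fun k => f (-k)) i L = (window f (1 - i - L) L).reverse := by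
  induction L generalizing i with
  | zero => rfl
  | succ L ih =>
    rw [window_succ f, List.reverse_append, window, ih]
    simp only [List.reverse_cons, List.reverse_nil, List.nil_append, List.singleton_append]
    congr 3 <;> push_cast <;> ring_nf

theorem window_map {β : Type*} (g : α → β) (f : ℤ → α) (i : ℤ) (L : ℕ) :
    window (fun k => g (f k)) i L = (window f i L).map g := by
  induction L generalizing i with
  | zero => rfl
  | succ L ih => simp [window, ih]

theorem window_eq_map_range (f : ℤ → α) (i : ℤ) (L : ℕ) :
    window f i L = (List.range L).map fun k : ℕ => f (i + k) := by
  induction L with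
  | zero => rfl
  | succ L ih => rw [window_succ, ih, List.range_succ, List.map_append]; rfl

end Words

/-! ### Entry bounds, reflection, and perturbation to complex energy -/

section Matrices

open Matrix

/-- All entries of the matrix are bounded by `K` in absolute value. -/
def EntriesLE (K : ℝ) (M : Matrix (Fin 2) (Fin 2) ℝ) : Prop := ∀ i j, |M i j| ≤ K

theorem EntriesLE.mono {K K' : ℝ} {M : Matrix (Fin 2) (Fin 2) ℝ} (h : EntriesLE K M)
    (hK : K ≤ K') : EntriesLE K' M := fun i j => (h i j).trans hK

theorem EntriesLE.mul {K K' : ℝ} {M M' : Matrix (Fin 2) (Fin 2) ℝ} (h : EntriesLE K M)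
    (h' : EntriesLE K' M') : EntriesLE (2 * K * K') (M * M') := by
  intro i j
  rw [Matrix.mul_apply, Fin.sum_univ_two]
  have hK : 0 ≤ K := (abs_nonneg _).trans (h 0 0)
  have key : ∀ k, |M i k * M' k j| ≤ K * K' := fun k => by
    rw [abs_mul]
    exact mul_le_mul (h i k) (h' k j) (abs_nonneg _) hK
  linarith [abs_add_le (M i 0 * M' 0 j) (M i 1 * M' 1 j), key 0, key 1]

theorem EntriesLE.adjugate {K : ℝ} {M : Matrix (Fin 2) (Fin 2) ℝ} (h : EntriesLE K M) :
    EntriesLE K M.adjugate := by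
  intro i j
  rw [Matrix.adjugate_fin_two]
  fin_cases i <;> fin_cases j <;> simp [h _ _]

theorem EntriesLE.neg {K : ℝ} {M : Matrix (Fin 2) (Fin 2) ℝ} (h : EntriesLE K M) :
    EntriesLE K (-M) := fun i j => by simpa using h i j

theorem det_transfer (x E : ℝ) : (transfer x E).det = 1 := by
  simp [transfer, Matrix.det_fin_two]

/-- The exchange of the two coordinates. -/
def swapMat : Matrix (Fin 2) (Fin 2) ℝ := !![0, 1; 1, 0]

theorem swapMat_mul_swapMat : swapMat * swapMat = 1 := by
  ext i j; fin_cases i <;> fin_cases j <;> simp [swapMat]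

/-- Time reversal: the determinant is 1, so the adjugate is the inverse, and exchanging the two
coordinates turns a backward step into a forward one. Bounds on forward products thereby serve on
the right half-line too. -/
theorem swapMat_mul_adjugate_transfer (x E : ℝ) :
    swapMat * (transfer x E).adjugate = transfer x E * swapMat := by
  rw [Matrix.adjugate_fin_two]
  ext i j; fin_cases i <;> fin_cases j <;> simp [swapMat, transfer]

theorem wordProd_transfer_reverse (E : ℝ) (w : List ℝ) :
    wordProd (fun x => transfer x E) w.reverse
      = swapMat * (wordProd (fun x => transfer x E) w).adjugate * swapMat := by
  induction w with
  | nil => simp [swapMat_mul_swapMat]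
  | cons x w ih =>
    rw [List.reverse_cons, wordProd_append, ih, wordProd_cons _ x w,
      Matrix.adjugate_mul_distrib, ← mul_assoc swapMat, swapMat_mul_adjugate_transfer]
    simp [mul_assoc]

theorem EntriesLE.swap_conj {K : ℝ} {M : Matrix (Fin 2) (Fin 2) ℝ} (h : EntriesLE K M) :
    EntriesLE K (swapMat * M * swapMat) := by
  have e : swapMat * M * swapMat = !![M 1 1, M 1 0; M 0 1, M 0 0] := by
    rw [M.eta_fin_two]
    simp [swapMat]
  intro i j
  rw [e]
  fin_cases i <;> fin_cases j <;> simp [h _ _]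

/-- Bounds on the transfer matrices of a potential pass to the reflected potential. -/
theorem entriesLE_window_neg {V : ℤ → ℝ} {E : ℝ} {F : ℕ → ℝ}
    (h : ∀ i L, EntriesLE (F L) (wordProd (fun x => transfer x E) (window V i L))) (i : ℤ) (L : ℕ) :
    EntriesLE (F L) (wordProd (fun x => transfer x E) (window (fun k => V (-k)) i L)) := by
  rw [window_neg, wordProd_transfer_reverse]
  exact (h _ _).adjugate.swap_conj

/-- The action of a real matrix on a complex vector. -/
noncomputable def act (M : Matrix (Fin 2) (Fin 2) ℝ) (v : Fin 2 → ℂ) : Fin 2 → ℂ :=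
  (Complex.ofRealHom.mapMatrix M) *ᵥ v

theorem act_mul (M M' : Matrix (Fin 2) (Fin 2) ℝ) (v : Fin 2 → ℂ) :
    act (M * M') v = act M (act M' v) := by
  simp only [act, map_mul, Matrix.mulVec_mulVec]

theorem act_add (M : Matrix (Fin 2) (Fin 2) ℝ) (v w : Fin 2 → ℂ) :
    act M (v + w) = act M v + act M w := Matrix.mulVec_add _ _ _

theorem act_one (v : Fin 2 → ℂ) : act 1 v = v := by
  simp only [act, map_one, Matrix.one_mulVec]

theorem EntriesLE.norm_act_le {K : ℝ} {M : Matrix (Fin 2) (Fin 2) ℝ} (h : EntriesLE K M)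
    (v : Fin 2 → ℂ) : ‖act M v‖ ≤ 2 * K * ‖v‖ := by
  have hK : 0 ≤ K := (abs_nonneg _).trans (h 0 0)
  refine (pi_norm_le_iff_of_nonneg (by positivity)).2 fun i => ?_
  have key : ∀ k, ‖(M i k : ℂ) * v k‖ ≤ K * ‖v‖ := fun k => by
    rw [norm_mul, Complex.norm_real, Real.norm_eq_abs]
    exact mul_le_mul (h i k) (norm_le_pi_norm v k) (norm_nonneg _) hK
  have : act M v i = (M i 0 : ℂ) * v 0 + (M i 1 : ℂ) * v 1 := by
    simp [act, Matrix.mulVec, dotProduct, Fin.sum_univ_two]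
  rw [this]
  linarith [norm_add_le ((M i 0 : ℂ) * v 0) ((M i 1 : ℂ) * v 1), key 0, key 1]

/-- Solutions at the complex energy `E + iη` grow at most by a factor governed by bounds on the
transfer matrices at the real energy `E`. -/
theorem norm_solution_le {V : ℤ → ℝ} {E η K : ℝ} {N : ℕ} (hη : 0 ≤ η)
    (hK : ∀ i L, L ≤ N → EntriesLE K (wordProd (fun x => transfer x E) (window V i L)))
    {h : ℤ → ℂ} {s : ℤ}
    (hs : ∀ k : ℕ, k < N →
      h (s + k + 1) = ((E : ℂ) + η * Complex.I - V (s + k)) * h (s + k) - h (s + k - 1))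
    {k : ℕ} (hk : k ≤ N) :
    ‖![h (s + k), h (s + k - 1)]‖ ≤ 2 * K * (1 + 2 * K * η) ^ k * ‖![h s, h (s - 1)]‖ := by
  have hK0 : 0 ≤ K := (abs_nonneg _).trans (hK 0 0 (Nat.zero_le _) 0 0)
  -- The induction carries `L` further steps at the real energy. The unperturbed part of each new
  -- step is then absorbed into a window of length `L + 1`, so `K` is not multiplied in at every
  -- site; only the error `iη h` costs a factor `1 + 2Kη`.
  have main : ∀ k : ℕ, ∀ L : ℕ, k + L ≤ N →
      ‖act (wordProd (fun x => transfer x E) (window V (s + k) L))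
        ![h (s + k), h (s + k - 1)]‖ ≤ 2 * K * (1 + 2 * K * η) ^ k * ‖![h s, h (s - 1)]‖ := by
    intro k
    induction k with
    | zero =>
      intro L hL
      simpa using (hK s L (by omega)).norm_act_le _
    | succ k ih =>
      intro L hL
      have e1 : s + ((k + 1 : ℕ) : ℤ) = s + k + 1 := by push_cast; ring
      have step : ![h (s + k + 1), h (s + k)]
          = act (transfer (V (s + k)) E) ![h (s + k), h (s + k - 1)]
            + ![η * Complex.I * h (s + k), 0] := by
        rw [hs k (by omega)]
        ext i
        fin_cases i
        · simp [act, transfer]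
          ring
        · simp [act, transfer]
      rw [e1, add_sub_cancel_right, step, act_add, ← act_mul]
      have h1 := ih (L + 1) (by omega)
      rw [window, wordProd_cons] at h1
      have h2 := (hK (s + k + 1) L (by omega)).norm_act_le ![η * Complex.I * h (s + k), 0]
      have h3 := ih 0 (by omega)
      rw [window, wordProd_nil, act_one] at h3
      have h4 : ‖![η * Complex.I * h (s + k), 0]‖ ≤ η * ‖![h (s + k), h (s + k - 1)]‖ := by
        refine (pi_norm_le_iff_of_nonneg (by positivity)).2 fun i => ?_
        fin_cases i
        · simp only [Fin.zero_eta, Matrix.cons_val_zero, norm_mul, Complex.norm_real,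
            Complex.norm_I, mul_one, Real.norm_eq_abs, abs_of_nonneg hη]
          exact mul_le_mul_of_nonneg_left
            (norm_le_pi_norm ![h (s + k), h (s + k - 1)] 0) hη
        · simp only [Fin.mk_one, Matrix.cons_val_one, Matrix.cons_val_fin_one, norm_zero]
          positivity
      refine (norm_add_le _ _).trans ((add_le_add h1 (h2.trans
        (mul_le_mul_of_nonneg_left (h4.trans (mul_le_mul_of_nonneg_left h3 hη))
          (by positivity)))).trans_eq ?_)
      ring
  simpa [window, act_one] using main k 0 (by omega)

end Matrices

end GenFib

namespace GenFib

/-! ### Time evolution, its Laplace transform, and averaged probabilities -/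

section Dynamics

open MeasureTheory Filter Topology

theorem inner_delta (n : ℤ) (f : ELL2) : inner ℂ (delta n) f = (f : ℤ → ℂ) n := by
  rw [delta, lp.inner_single_left]
  simp

theorem delta_apply (n k : ℤ) : (delta n : ℤ → ℂ) k = if k = n then 1 else 0 := by
  rw [delta, lp.coeFn_single, Pi.single_apply]

theorem inner_shift_left (k : ℤ) (ψ φ : ELL2) :
    inner ℂ (shift k ψ) φ = inner ℂ ψ (shift (-k) φ) := by
  rw [lp.inner_eq_tsum, lp.inner_eq_tsum, 
    ← (Equiv.addRight k).tsum_eq fun n => inner ℂ ((ψ : ℤ → ℂ) n) ((shift (-k) φ : ℤ → ℂ) n)]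
  refine tsum_congr fun n => ?_
  change inner ℂ ((ψ : ℤ → ℂ) (n + k)) ((φ : ℤ → ℂ) n)
    = inner ℂ ((ψ : ℤ → ℂ) (n + k)) ((φ : ℤ → ℂ) (n + k + -k))
  rw [add_neg_cancel_right]

theorem inner_mulPotential_left (V : ℤ → ℝ) (hV : ∃ C : ℝ, ∀ n, |V n| ≤ C) (ψ φ : ELL2) :
    inner ℂ (mulPotential V hV ψ) φ = inner ℂ ψ (mulPotential V hV φ) := by
  rw [lp.inner_eq_tsum, lp.inner_eq_tsum]
  refine tsum_congr fun n => ?_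
  change inner ℂ ((V n : ℂ) * (ψ : ℤ → ℂ) n) ((φ : ℤ → ℂ) n)
    = inner ℂ ((ψ : ℤ → ℂ) n) ((V n : ℂ) * (φ : ℤ → ℂ) n)
  simp
  ring

theorem isSelfAdjoint_schrodinger (V : ℤ → ℝ) (hV : ∃ C : ℝ, ∀ n, |V n| ≤ C) :
    IsSelfAdjoint (schrodinger V hV) := by
  rw [ContinuousLinearMap.isSelfAdjoint_iff_isSymmetric]
  intro ψ φ
  change inner ℂ (shift (-1) ψ + shift 1 ψ + mulPotential V hV ψ) φ
    = inner ℂ ψ (shift (-1) φ + shift 1 φ + mulPotential V hV φ)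
  simp only [inner_add_left, inner_add_right, inner_shift_left, inner_mulPotential_left, neg_neg]
  ring

theorem norm_evolution_apply_le {H : ELL2 →L[ℂ] ELL2} (hH : IsSelfAdjoint H) (t : ℝ) (ψ : ELL2) :
    ‖evolution H t ψ‖ ≤ ‖ψ‖ := by
  have h : evolution H t ∈ unitary (ELL2 →L[ℂ] ELL2) := by
    let _ : NormedAlgebra ℚ (ELL2 →L[ℂ] ELL2) := .restrictScalars ℚ ℂ _
    refine NormedSpace.exp_mem_unitary_of_mem_skewAdjoint ?_
    rw [skewAdjoint.mem_iff, star_smul, hH.star_eq]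
    simp
  exact (ContinuousLinearMap.norm_map_of_mem_unitary h ψ).le

/-- The amplitude `⟨δ_n, exp(-itH) ψ⟩`. -/
noncomputable def amplitude (H : ELL2 →L[ℂ] ELL2) (ψ : ELL2) (n : ℤ) (t : ℝ) : ℂ :=
  (evolution H t ψ : ℤ → ℂ) n

theorem norm_amplitude_le {H : ELL2 →L[ℂ] ELL2} (hH : IsSelfAdjoint H) (ψ : ELL2) (n : ℤ) (t : ℝ) :
    ‖amplitude H ψ n t‖ ≤ ‖ψ‖ :=
  (lp.norm_apply_le_norm (by norm_num) _ n).trans (norm_evolution_apply_le hH t ψ)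

theorem amplitude_zero (H : ELL2 →L[ℂ] ELL2) (ψ : ELL2) (n : ℤ) :
    amplitude H ψ n 0 = (ψ : ℤ → ℂ) n := by
  simp [amplitude, evolution]

theorem hasDerivAt_amplitude (H : ELL2 →L[ℂ] ELL2) (ψ : ELL2) (n : ℤ) (t : ℝ) :
    HasDerivAt (amplitude H ψ n) (-Complex.I * (H (evolution H t ψ) : ℤ → ℂ) n) t := by
  have h1 : HasDerivAt (fun t : ℝ => -(Complex.I * (t : ℂ))) (-Complex.I) t := by
    simpa using ((Complex.ofRealCLM.hasDerivAt (x := t)).const_mul Complex.I).fun_neg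
  have h2 := (hasDerivAt_exp_smul_const' (𝕂 := ℂ) H (-(Complex.I * (t : ℂ)))).scomp t h1
  let L : (ELL2 →L[ℂ] ELL2) →L[ℂ] ℂ :=
    (innerSL ℂ (delta n)).comp (ContinuousLinearMap.apply ℂ ELL2 ψ)
  have hL : ∀ A, L A = (A ψ : ℤ → ℂ) n := fun A => inner_delta n (A ψ)
  have h3 := (L.restrictScalars ℝ).hasFDerivAt.comp_hasDerivAt t h2
  refine (h3.congr_deriv ?_).congr_of_eventuallyEq (Eventually.of_forall fun s => ?_)
  · simp only [ContinuousLinearMap.coe_restrictScalars', hL]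
    rfl
  · exact (hL _).symm

theorem continuous_amplitude (H : ELL2 →L[ℂ] ELL2) (ψ : ELL2) (n : ℤ) :
    Continuous (amplitude H ψ n) :=
  continuous_iff_continuousAt.2 fun t => (hasDerivAt_amplitude H ψ n t).continuousAt

theorem amplitude_schrodinger (V : ℤ → ℝ) (hV : ∃ C : ℝ, ∀ n, |V n| ≤ C) (ψ : ELL2) (n : ℤ)
    (t : ℝ) : (schrodinger V hV (evolution (schrodinger V hV) t ψ) : ℤ → ℂ) n
      = amplitude (schrodinger V hV) ψ (n - 1) t + amplitude (schrodinger V hV) ψ (n + 1) t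
        + (V n : ℂ) * amplitude (schrodinger V hV) ψ n t := rfl

theorem norm_exp_energy (E η t : ℝ) :
    ‖Complex.exp (Complex.I * ((E : ℂ) + η * Complex.I) * t)‖ = Real.exp (-η * t) := by
  rw [Complex.norm_exp]
  congr 1
  simp

/-- The Laplace transform of the amplitude, that is, `i` times a matrix element of the resolvent
at the energy `E + iη`. -/
noncomputable def green (H : ELL2 →L[ℂ] ELL2) (ψ : ELL2) (E η : ℝ) (n : ℤ) : ℂ :=
  ∫ t in Set.Ioi (0 : ℝ),
    Complex.exp (Complex.I * ((E : ℂ) + η * Complex.I) * t) * amplitude H ψ n t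

theorem integrable_green {H : ELL2 →L[ℂ] ELL2} (hH : IsSelfAdjoint H) (ψ : ELL2) (E : ℝ) {η : ℝ}
    (hη : 0 < η) (n : ℤ) : IntegrableOn (fun t : ℝ =>
      Complex.exp (Complex.I * ((E : ℂ) + η * Complex.I) * t) * amplitude H ψ n t)
      (Set.Ioi 0) := by
  have hc := continuous_amplitude H ψ n
  refine Integrable.mono' ((exp_neg_integrableOn_Ioi 0 hη).mul_const ‖ψ‖)
    (Continuous.aestronglyMeasurable (by fun_prop)) (Eventually.of_forall fun t => ?_)
  rw [norm_mul, norm_exp_energy]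
  exact mul_le_mul_of_nonneg_left (norm_amplitude_le hH ψ n t) (Real.exp_pos _).le

/-- Integrate the derivative of `exp(izt)` times the amplitude over the half-line: the boundary term
at 0 is the source `ψ n`, and the one at infinity vanishes because `η > 0` and the amplitude is
bounded. -/
theorem green_equation (V : ℤ → ℝ) (hV : ∃ C : ℝ, ∀ n, |V n| ≤ C) (ψ : ELL2) (E : ℝ) {η : ℝ}
    (hη : 0 < η) (n : ℤ) :
    green (schrodinger V hV) ψ E η (n - 1) + green (schrodinger V hV) ψ E η (n + 1)
      + ((V n : ℂ) - (E + η * Complex.I)) * green (schrodinger V hV) ψ E η n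
      = -Complex.I * (ψ : ℤ → ℂ) n := by
  set H := schrodinger V hV
  set z : ℂ := (E : ℂ) + η * Complex.I with hz
  have hH : IsSelfAdjoint H := isSelfAdjoint_schrodinger V hV
  have i0 := integrable_green hH ψ E hη n
  have i1 := integrable_green hH ψ E hη (n - 1)
  have i2 := integrable_green hH ψ E hη (n + 1)
  rw [← hz] at i0 i1 i2
  let f : ℝ → ℂ := fun t => Complex.exp (Complex.I * z * t) * amplitude H ψ n t
  have hderiv : ∀ t : ℝ, HasDerivAt f
      (-Complex.I * (Complex.exp (Complex.I * z * t) * amplitude H ψ (n - 1) t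
        + Complex.exp (Complex.I * z * t) * amplitude H ψ (n + 1) t
        + ((V n : ℂ) - z) * (Complex.exp (Complex.I * z * t) * amplitude H ψ n t))) t := by
    intro t
    have e1 : HasDerivAt (fun t : ℝ => Complex.exp (Complex.I * z * t))
        (Complex.exp (Complex.I * z * t) * (Complex.I * z)) t := by
      simpa using ((Complex.ofRealCLM.hasDerivAt (x := t)).const_mul (Complex.I * z)).cexp
    refine (e1.mul (hasDerivAt_amplitude H ψ n t)).congr_deriv ?_
    rw [amplitude_schrodinger]
    ring
  have i12 : IntegrableOn (fun t : ℝ => Complex.exp (Complex.I * z * t) * amplitude H ψ (n - 1) t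
      + Complex.exp (Complex.I * z * t) * amplitude H ψ (n + 1) t) (Set.Ioi 0) := i1.add i2
  have hint := (i12.add (i0.const_mul ((V n : ℂ) - z))).const_mul (-Complex.I)
  have hlim : Tendsto f atTop (𝓝 0) := by
    refine squeeze_zero_norm (a := fun t => Real.exp (-η * t) * ‖ψ‖) (fun t => ?_) ?_
    · rw [norm_mul, norm_exp_energy]
      exact mul_le_mul_of_nonneg_left (norm_amplitude_le hH ψ n t) (Real.exp_pos _).le
    · have : Tendsto (fun t : ℝ => Real.exp (-η * t)) atTop (𝓝 0) := by
        refine Real.tendsto_exp_atBot.comp ?_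
        exact tendsto_id.const_mul_atTop_of_neg (by linarith)
      simpa using this.mul_const ‖ψ‖
  have key := integral_Ioi_of_hasDerivAt_of_tendsto (a := 0) (f := f)
    (hderiv 0).continuousAt.continuousWithinAt (fun t _ => hderiv t) hint hlim
  have hf0 : f 0 = (ψ : ℤ → ℂ) n := by simp [f, amplitude_zero]
  rw [hf0, integral_const_mul, integral_add i12 (i0.const_mul _), integral_add i1 i2,
    integral_const_mul] at key
  change -Complex.I * (green H ψ E η (n - 1) + green H ψ E η (n + 1)
    + ((V n : ℂ) - z) * green H ψ E η n) = _ at key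
  linear_combination Complex.I * key + (green H ψ E η (n - 1) + green H ψ E η (n + 1)
    + ((V n : ℂ) - z) * green H ψ E η n) * Complex.I_sq

/-- Cauchy–Schwarz for the weight `exp(-2t/T)` of total mass `T/2`. The choice `η = 2/T` makes
`|exp(izt)|` equal to this weight, so one energy suffices and no integration over `E` is needed. -/
theorem le_avgProb {H : ELL2 →L[ℂ] ELL2} (hH : IsSelfAdjoint H) (ψ : ELL2) (E : ℝ) {T : ℝ}
    (hT : 0 < T) (n : ℤ) :
    ENNReal.ofReal (2 / T ^ 2 * ‖green H ψ E (2 / T) n‖ ^ 2) ≤ avgProb H ψ n T := by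
  have hη : 0 < 2 / T := by positivity
  have hc := continuous_amplitude H ψ n
  let w : ℝ → ℝ := fun t => Real.exp (-(2 / T) * t)
  have hw : IntegrableOn w (Set.Ioi 0) := exp_neg_integrableOn_Ioi 0 hη
  have hw0 : ∫ t in Set.Ioi (0 : ℝ), w t = T / 2 := by
    have := integral_exp_mul_Ioi (a := -(2 / T)) (by linarith) 0
    rw [this]
    simp
  have h1 : IntegrableOn (fun t => w t * ‖amplitude H ψ n t‖) (Set.Ioi 0) := by
    refine (integrable_green hH ψ E hη n).norm.congr (Eventually.of_forall fun t => ?_)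
    simp only [norm_mul, norm_exp_energy, w]
  have h2 : IntegrableOn (fun t => w t * ‖amplitude H ψ n t‖ ^ 2) (Set.Ioi 0) := by
    refine Integrable.mono' (hw.mul_const (‖ψ‖ ^ 2))
      (Continuous.aestronglyMeasurable (by fun_prop)) (Eventually.of_forall fun t => ?_)
    rw [Real.norm_of_nonneg (by positivity)]
    have := norm_amplitude_le hH ψ n t
    gcongr
  set A := ∫ t in Set.Ioi (0 : ℝ), w t * ‖amplitude H ψ n t‖ with hA
  set B := ∫ t in Set.Ioi (0 : ℝ), w t * ‖amplitude H ψ n t‖ ^ 2 with hB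
  have hgA : ‖green H ψ E (2 / T) n‖ ≤ A := by
    refine (norm_integral_le_integral_norm _).trans_eq ?_
    refine integral_congr_ae (Eventually.of_forall fun t => ?_)
    simp only [norm_mul, norm_exp_energy, w]
  have h12 : ∀ c : ℝ, IntegrableOn (fun t => w t * ‖amplitude H ψ n t‖ ^ 2
      - 2 * c * (w t * ‖amplitude H ψ n t‖)) (Set.Ioi 0) := fun c => h2.sub (h1.const_mul _)
  have hcs : ∀ c : ℝ, 0 ≤ B - 2 * c * A + c ^ 2 * (T / 2) := by
    intro c
    have : 0 ≤ ∫ t in Set.Ioi (0 : ℝ), (w t * ‖amplitude H ψ n t‖ ^ 2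
        - 2 * c * (w t * ‖amplitude H ψ n t‖) + c ^ 2 * w t) := by
      refine integral_nonneg fun t => ?_
      have e : w t * ‖amplitude H ψ n t‖ ^ 2 - 2 * c * (w t * ‖amplitude H ψ n t‖) + c ^ 2 * w t
        = w t * (‖amplitude H ψ n t‖ - c) ^ 2 := by ring
      simp only [e]
      positivity
    rwa [integral_add (h12 c) (hw.const_mul _), integral_sub h2 (h1.const_mul _),
      integral_const_mul, integral_const_mul, hw0] at this
  have hAB : A ^ 2 ≤ T / 2 * B := by
    -- The value `c = 2A/T` minimizes the quadratic in `c`.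
    have := hcs (2 / T * A)
    have e : B - 2 * (2 / T * A) * A + (2 / T * A) ^ 2 * (T / 2) = B - 2 / T * A ^ 2 := by
      field_simp
      ring
    rw [e] at this
    calc A ^ 2 = T / 2 * (2 / T * A ^ 2) := by field_simp
      _ ≤ T / 2 * B := by gcongr; linarith
  have hval : avgProb H ψ n T = ENNReal.ofReal (1 / T * B) := by
    rw [avgProb, ENNReal.ofReal_mul (by positivity), hB,
      ofReal_integral_eq_lintegral_ofReal h2 (Eventually.of_forall fun t => by positivity)]
    congr 2
    funext t
    rw [inner_delta]
    congr 3
    ring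
  rw [hval]
  refine ENNReal.ofReal_le_ofReal ?_
  calc 2 / T ^ 2 * ‖green H ψ E (2 / T) n‖ ^ 2 ≤ 2 / T ^ 2 * (T / 2 * B) := by
        gcongr
        exact (pow_le_pow_left₀ (norm_nonneg _) hgA 2).trans hAB
    _ = 1 / T * B := by field_simp

end Dynamics

end GenFib

namespace GenFib

/-! ### From transfer matrix bounds to transport exponents -/

section PowerLaw

open Filter Topology

theorem norm_vec_le {x y : ℂ} {c : ℝ} (hx : ‖x‖ ≤ c) (hy : ‖y‖ ≤ c) : ‖![x, y]‖ ≤ c := by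
  refine (pi_norm_le_iff_of_nonneg ((norm_nonneg _).trans hx)).2 fun i => ?_
  fin_cases i
  · exact hx
  · exact hy

theorem norm_vec_sq_le (x y : ℂ) : ‖![x, y]‖ ^ 2 ≤ ‖x‖ ^ 2 + ‖y‖ ^ 2 := by
  have h : ‖![x, y]‖ ≤ √(‖x‖ ^ 2 + ‖y‖ ^ 2) :=
    norm_vec_le (Real.le_sqrt_of_sq_le (by linarith [sq_nonneg ‖y‖]))
      (Real.le_sqrt_of_sq_le (by linarith [sq_nonneg ‖x‖]))
  exact (Real.le_sqrt (norm_nonneg _) (by positivity)).1 h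

/-- The resolvent matrix elements are bounded from below on one of the two half-lines. -/
theorem green_lower_bound {V : ℤ → ℝ} (hV : ∃ C : ℝ, ∀ n, |V n| ≤ C) {E η K W Q : ℝ} {N : ℕ}
    (hη : 0 < η)
    (hK : ∀ i L, L ≤ N → EntriesLE K (wordProd (fun x => transfer x E) (window V i L)))
    (hK' : ∀ i L, L ≤ N →
      EntriesLE K (wordProd (fun x => transfer x E) (window (fun k => V (-k)) i L)))
    (hW : |V 1| + |E| + η ≤ W) (hQ : ∀ k ≤ N, 2 * K * (1 + 2 * K * η) ^ k ≤ Q) :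
    let G := green (schrodinger V hV) (delta 1) E η
    (∀ k : ℕ, k ≤ N → 1 ≤ (2 + W) * Q * ‖![G (1 + k), G (2 + k)]‖) ∨
      (∀ k : ℕ, k ≤ N → 1 ≤ (2 + W) * Q * ‖![G (1 - k), G (-k)]‖) := by
  intro G
  have eqn : ∀ n : ℤ, G (n - 1) + G (n + 1) + ((V n : ℂ) - (E + η * Complex.I)) * G n
      = -Complex.I * if n = 1 then 1 else 0 := fun n => by
    rw [← delta_apply]
    exact green_equation V hV (delta 1) E hη n
  have hW0 : 0 ≤ W := le_trans (by positivity) hW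
  -- Propagate from far out back towards the source, for the reflected potential. Only the equations
  -- at sites `2, …, k + 1` enter, so the source at site 1 is not crossed.
  have right : ∀ k : ℕ, k ≤ N → ‖![G 1, G 2]‖ ≤ Q * ‖![G (1 + k), G (2 + k)]‖ := by
    intro k hk
    have h := norm_solution_le (V := fun k => V (-k)) (E := E) (N := k) hη.le
      (fun i L hL => hK' i L (hL.trans hk)) (h := fun j => G (-j)) (s := -1 - k) (fun i hi => by
        have e := eqn (1 + k - i)
        rw [if_neg (by omega)] at e
        have e1 : -((-1 - k + i + 1 : ℤ)) = 1 + k - i - 1 := by ring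
        have e2 : -((-1 - k + i : ℤ)) = 1 + k - i := by ring
        have e3 : -((-1 - k + i - 1 : ℤ)) = 1 + k - i + 1 := by ring
        simp only [e1, e2, e3]
        linear_combination e) le_rfl
    have e1 : -((-1 - k + k : ℤ)) = 1 := by ring
    have e2 : -((-1 - k + k - 1 : ℤ)) = 2 := by ring
    have e3 : -((-1 - k : ℤ)) = 1 + k := by ring
    have e4 : -((-1 - k - 1 : ℤ)) = 2 + k := by ring
    simp only [e1, e2, e3, e4] at h
    exact h.trans (mul_le_mul_of_nonneg_right (hQ k hk) (norm_nonneg _))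
  have left : ∀ k : ℕ, k ≤ N → ‖![G 1, G 0]‖ ≤ Q * ‖![G (1 - k), G (-k)]‖ := by
    intro k hk
    have h := norm_solution_le (V := V) (E := E) (N := k) hη.le
      (fun i L hL => hK i L (hL.trans hk)) (h := G) (s := 1 - k) (fun i hi => by
        have e := eqn (1 - k + i)
        rw [if_neg (by omega)] at e
        linear_combination e) le_rfl
    have e1 : (1 - k + k : ℤ) = 1 := by ring
    have e2 : (1 - k - 1 : ℤ) = -k := by ring
    simp only [e1, e2, sub_self] at h
    exact h.trans (mul_le_mul_of_nonneg_right (hQ k hk) (norm_nonneg _))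
  -- The source has modulus 1, so the equation at site 1 prevents `G 0`, `G 1`, `G 2` from all being
  -- small.
  have key : ∀ c : ℝ, ‖![G 1, G 2]‖ ≤ c → ‖![G 1, G 0]‖ ≤ c → 1 ≤ (2 + W) * c := by
    intro c h1 h2
    have b1 : ‖G 1‖ ≤ c := (norm_le_pi_norm ![G 1, G 2] 0).trans h1
    have b2 : ‖G 2‖ ≤ c := (norm_le_pi_norm ![G 1, G 2] 1).trans h1
    have b0 : ‖G 0‖ ≤ c := (norm_le_pi_norm ![G 1, G 0] 1).trans h2
    have e := congrArg norm (eqn 1)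
    norm_num at e
    have bz : ‖(V 1 : ℂ) - (E + η * Complex.I)‖ ≤ W := by
      refine le_trans ?_ hW
      refine (norm_sub_le _ _).trans ?_
      rw [add_assoc]
      refine add_le_add (by simp) ((norm_add_le _ _).trans ?_)
      simp [abs_of_pos hη]
    have := norm_add₃_le (a := G 0) (b := G 2) (c := ((V 1 : ℂ) - (E + η * Complex.I)) * G 1)
    rw [e, norm_mul] at this
    have := mul_le_mul bz b1 (norm_nonneg _) hW0
    linarith
  -- The half-line chosen is the one next to the larger of the two vectors, since a bound on the
  -- larger is a bound on both.
  rcases le_total ‖![G 1, G 2]‖ ‖![G 1, G 0]‖ with h | h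
  · right
    intro k hk
    have h1 := left k hk
    have := key _ (h.trans h1) h1
    linarith
  · left
    intro k hk
    have h1 := right k hk
    have := key _ h1 (h.trans h1)
    linarith

/-- Each site is counted at most once by each injection. It is applied to overlapping pairs of
neighbouring sites, because only the pair `(G n, G n')` is bounded below, not each entry. -/
theorem card_mul_le_two_mul_tsum {F : ℤ → ℝ≥0∞} {c : ℝ≥0∞} {e₁ e₂ : ℕ → ℤ}
    (h₁ : Function.Injective e₁) (h₂ : Function.Injective e₂) (s : Finset ℕ)
    (h : ∀ k ∈ s, c ≤ F (e₁ k) + F (e₂ k)) : (s.card : ℝ≥0∞) * c ≤ 2 * ∑' n, F n := by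
  have aux : ∀ e : ℕ → ℤ, Function.Injective e → ∑ k ∈ s, F (e k) ≤ ∑' n, F n := fun e he =>
    (ENNReal.sum_le_tsum s).trans (ENNReal.tsum_comp_le_tsum_of_injective he F)
  calc (s.card : ℝ≥0∞) * c = ∑ _k ∈ s, c := by rw [Finset.sum_const, nsmul_eq_mul]
    _ ≤ ∑ k ∈ s, (F (e₁ k) + F (e₂ k)) := Finset.sum_le_sum h
    _ ≤ 2 * ∑' n, F n := by
      rw [Finset.sum_add_distrib, two_mul]
      exact add_le_add (aux e₁ h₁) (aux e₂ h₂)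

theorem moment_lower_bound {V : ℤ → ℝ} (hV : ∃ C : ℝ, ∀ n, |V n| ≤ C) {E K W Q p T : ℝ} {N : ℕ}
    (hT : 0 < T) (hp : 0 < p)
    (hK : ∀ i L, L ≤ 2 * N → EntriesLE K (wordProd (fun x => transfer x E) (window V i L)))
    (hK' : ∀ i L, L ≤ 2 * N →
      EntriesLE K (wordProd (fun x => transfer x E) (window (fun k => V (-k)) i L)))
    (hW : |V 1| + |E| + 2 / T ≤ W)
    (hQ : ∀ k ≤ 2 * N, 2 * K * (1 + 2 * K * (2 / T)) ^ k ≤ Q) :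
    ENNReal.ofReal ((N : ℝ) ^ p * N / (T ^ 2 * ((2 + W) * Q) ^ 2))
      ≤ moment (schrodinger V hV) (delta 1) p T := by
  set H := schrodinger V hV with hH
  have hη : 0 < 2 / T := by positivity
  set G := green H (delta 1) E (2 / T) with hG
  set F : ℤ → ℝ≥0∞ := fun n => ENNReal.ofReal (|(n : ℝ)| ^ p) * avgProb H (delta 1) n T with hF
  have hK0 : 0 ≤ K := (abs_nonneg _).trans (hK 0 0 (Nat.zero_le _) 0 0)
  have hQ0 : 0 ≤ Q := le_trans (by positivity) (hQ 0 (Nat.zero_le _))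
  have hW0 : 0 ≤ W := le_trans (by positivity) hW
  have hFle : ∀ n : ℤ, (N : ℤ) ≤ |n| →
      ENNReal.ofReal ((N : ℝ) ^ p * (2 / T ^ 2 * ‖G n‖ ^ 2)) ≤ F n := by
    intro n hn
    rw [ENNReal.ofReal_mul (by positivity)]
    refine mul_le_mul' (ENNReal.ofReal_le_ofReal ?_)
      (le_avgProb (isSelfAdjoint_schrodinger V hV) _ E hT n)
    refine Real.rpow_le_rpow (by positivity) ?_ hp.le
    exact_mod_cast hn
  have hpair : ∀ n n' : ℤ, (N : ℤ) ≤ |n| → (N : ℤ) ≤ |n'| →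
      1 ≤ (2 + W) * Q * ‖![G n, G n']‖ →
      ENNReal.ofReal ((N : ℝ) ^ p * (2 / T ^ 2 * (1 / ((2 + W) * Q) ^ 2))) ≤ F n + F n' := by
    intro n n' hn hn' h
    refine le_trans ?_ (add_le_add (hFle n hn) (hFle n' hn'))
    rw [← ENNReal.ofReal_add (by positivity) (by positivity)]
    refine ENNReal.ofReal_le_ofReal ?_
    rw [← mul_add, ← mul_add]
    have hpos : 0 < (2 + W) * Q := by
      rcases hQ0.eq_or_lt with h0 | h0
      · rw [← h0] at h
        norm_num at h
      · positivity
    have : 1 / ((2 + W) * Q) ^ 2 ≤ ‖G n‖ ^ 2 + ‖G n'‖ ^ 2 := by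
      refine le_trans ?_ (norm_vec_sq_le _ _)
      rw [div_le_iff₀ (by positivity), ← mul_pow, mul_comm]
      exact one_le_pow₀ h
    gcongr
  -- There are exactly `N` indices; starting at `N + 1` ensures `|1 - k| ≥ N` on the left half-line.
  have hsum : ((Finset.Icc (N + 1) (2 * N)).card : ℝ≥0∞)
      * ENNReal.ofReal ((N : ℝ) ^ p * (2 / T ^ 2 * (1 / ((2 + W) * Q) ^ 2))) ≤ 2 * ∑' n, F n := by
    rcases green_lower_bound hV hη hK hK' hW hQ with h | h
    · refine card_mul_le_two_mul_tsum (e₁ := fun k : ℕ => 1 + (k : ℤ))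
        (e₂ := fun k : ℕ => 2 + (k : ℤ)) (fun x y => by simp) (fun x y => by simp) _ fun k hk => ?_
      rw [Finset.mem_Icc] at hk
      exact hpair _ _ (by rw [abs_of_nonneg (by omega)]; omega)
        (by rw [abs_of_nonneg (by omega)]; omega) (h k hk.2)
    · refine card_mul_le_two_mul_tsum (e₁ := fun k : ℕ => 1 - (k : ℤ))
        (e₂ := fun k : ℕ => -(k : ℤ)) (fun x y => by simp) (fun x y => by simp) _ fun k hk => ?_
      rw [Finset.mem_Icc] at hk
      exact hpair _ _ (by rw [abs_of_nonpos (by omega)]; omega)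
        (by rw [abs_of_nonpos (by omega)]; omega) (h k hk.2)
  have hcard : ((Finset.Icc (N + 1) (2 * N)).card : ℝ≥0∞) = ENNReal.ofReal N := by
    rw [Nat.card_Icc, ENNReal.ofReal_natCast]
    congr 1
    omega
  rw [hcard, ← ENNReal.ofReal_mul (by positivity)] at hsum
  have e : (N : ℝ) * ((N : ℝ) ^ p * (2 / T ^ 2 * (1 / ((2 + W) * Q) ^ 2)))
      = 2 * ((N : ℝ) ^ p * N / (T ^ 2 * ((2 + W) * Q) ^ 2)) := by
    simp only [div_eq_mul_inv, mul_inv]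
    ring
  rw [e, ENNReal.ofReal_mul (by norm_num), ENNReal.ofReal_ofNat] at hsum
  exact (ENNReal.mul_le_mul_iff_right (by norm_num) (by norm_num)).1 hsum

/-- The constant is lost in the limit: `log c / log T → 0`. -/
theorem betaMinus_ge_of_moment_ge {H : ELL2 →L[ℂ] ELL2} {ψ : ELL2} {p c γ : ℝ} (hc : 0 < c)
    (h : ∀ᶠ T : ℝ in atTop, ENNReal.ofReal (c * T ^ γ) ≤ moment H ψ p T) :
    (γ : EReal) ≤ betaMinus H ψ p := by
  have hlim : Tendsto (fun T : ℝ => ((Real.log c / Real.log T + γ : ℝ) : EReal)) atTop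
      (𝓝 (γ : EReal)) := by
    refine (continuous_coe_real_ereal.tendsto _).comp ?_
    simpa using (Real.tendsto_log_atTop.const_div_atTop (Real.log c)).add_const γ
  rw [← hlim.liminf_eq]
  refine liminf_le_liminf ?_
  filter_upwards [h, eventually_gt_atTop 1] with T hT h1
  have hl : 0 < Real.log T := Real.log_pos h1
  have hT0 : 0 < T := by linarith
  have e : Real.log c / Real.log T + γ = Real.log (c * T ^ γ) / Real.log T := by
    rw [Real.log_mul hc.ne' (by positivity), Real.log_rpow hT0]
    field_simp
  rw [e, EReal.coe_div, ← ENNReal.log_ofReal_of_pos (by positivity)]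
  exact EReal.div_le_div_right_of_nonneg (by exact_mod_cast hl.le) (ENNReal.log_monotone hT)

/-- A power-law bound on the transfer matrices at one energy implies a lower bound on the
transport exponents. -/
theorem betaMinus_ge_of_transfer_power_law {V : ℤ → ℝ} (hV : ∃ C : ℝ, ∀ n, |V n| ≤ C) {E C α : ℝ}
    (hα : 0 ≤ α)
    (h : ∀ (i : ℤ) (L : ℕ), EntriesLE (C * ((L : ℝ) + 1) ^ α)
      (wordProd (fun x => transfer x E) (window V i L)))
    {p : ℝ} (hp : 0 < p) :
    (((p - 1 - 4 * α) / (1 + α) : ℝ) : EReal) ≤ betaMinus (schrodinger V hV) (delta 1) p := by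
  have h' := entriesLE_window_neg (F := fun L : ℕ => C * ((L : ℝ) + 1) ^ α) h
  -- The empty window gives the identity, whence `1 ≤ C`.
  have hC : 0 < C := by
    have := h 0 0 0 0
    simp [window] at this
    linarith
  -- The factor `3^α` absorbs `L + 1 ≤ 3x`, valid for `L ≤ 2N ≤ 2x` and `1 ≤ x`.
  set C₀ := C * 3 ^ α with hC₀
  set W := |V 1| + |E| + 2 with hW
  set C₁ := (2 + W) * (2 * C₀ * Real.exp (8 * C₀)) with hC₁
  have hC₀p : 0 < C₀ := by positivity
  have hWp : 0 < W := by positivity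
  have hC₁p : 0 < C₁ := by positivity
  refine betaMinus_ge_of_moment_ge (c := (1 / 2) ^ p * (1 / 2) / C₁ ^ 2) (by positivity) ?_
  filter_upwards [eventually_ge_atTop 1] with T hT
  have hT0 : 0 < T := by linarith
  -- The critical scale `x^α · x = T`: over `2x` sites the errors `2Kη` with `K = C₀ x^α`, `η = 2/T`
  -- add up to `8 C₀`, which explains the factor `exp(8 C₀)`.
  set x := T ^ (1 / (1 + α)) with hx
  have hx1 : 1 ≤ x := Real.one_le_rpow hT (by positivity)
  have hx0 : 0 < x := by linarith
  have hxT : x ^ α * x = T := by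
    rw [← Real.rpow_add_one hx0.ne', hx, ← Real.rpow_mul hT0.le]
    convert Real.rpow_one T using 2
    field_simp
    ring
  set N := ⌊x⌋₊ with hN
  have hNx : (N : ℝ) ≤ x := Nat.floor_le hx0.le
  have hNx' : 1 / 2 * x ≤ N := by
    have h1 : x < N + 1 := Nat.lt_floor_add_one x
    have h2 : (1 : ℝ) ≤ N := by exact_mod_cast (Nat.one_le_floor_iff x).2 hx1
    linarith
  have hmono : ∀ L : ℕ, L ≤ 2 * N → C * ((L : ℝ) + 1) ^ α ≤ C₀ * x ^ α := by
    intro L hL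
    have hL' : (L : ℝ) ≤ 2 * N := by exact_mod_cast hL
    rw [hC₀, mul_assoc, ← Real.mul_rpow (by norm_num) hx0.le]
    gcongr
    linarith
  have hQ : ∀ k ≤ 2 * N, 2 * (C₀ * x ^ α) * (1 + 2 * (C₀ * x ^ α) * (2 / T)) ^ k
      ≤ 2 * C₀ * Real.exp (8 * C₀) * x ^ α := by
    intro k hk
    have hk' : (k : ℝ) ≤ 2 * x := by
      have : (k : ℝ) ≤ 2 * N := by exact_mod_cast hk
      linarith
    have : (1 + 2 * (C₀ * x ^ α) * (2 / T)) ^ k ≤ Real.exp (8 * C₀) := by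
      calc (1 + 2 * (C₀ * x ^ α) * (2 / T)) ^ k
          ≤ Real.exp (2 * (C₀ * x ^ α) * (2 / T)) ^ k := by
            refine pow_le_pow_left₀ (by positivity) ?_ k
            linarith [Real.add_one_le_exp (2 * (C₀ * x ^ α) * (2 / T))]
        _ = Real.exp (k * (2 * (C₀ * x ^ α) * (2 / T))) := by rw [← Real.exp_nat_mul]
        _ ≤ Real.exp (2 * x * (2 * (C₀ * x ^ α) * (2 / T))) := by gcongr
        _ = Real.exp (8 * C₀) := by
            congr 1
            calc 2 * x * (2 * (C₀ * x ^ α) * (2 / T)) = 8 * C₀ * (x ^ α * x) / T := by ring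
              _ = 8 * C₀ := by rw [hxT]; field_simp
    calc 2 * (C₀ * x ^ α) * (1 + 2 * (C₀ * x ^ α) * (2 / T)) ^ k
        ≤ 2 * (C₀ * x ^ α) * Real.exp (8 * C₀) := by gcongr
      _ = 2 * C₀ * Real.exp (8 * C₀) * x ^ α := by ring
  have hWT : |V 1| + |E| + 2 / T ≤ W := by
    have : 2 / T ≤ 2 := div_le_self (by norm_num) hT
    linarith
  refine le_trans (ENNReal.ofReal_le_ofReal ?_) (moment_lower_bound hV hT0 hp
    (fun i L hL => (h i L).mono (hmono L hL)) (fun i L hL => (h' i L).mono (hmono L hL)) hWT hQ)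
  have hγ : T ^ ((p - 1 - 4 * α) / (1 + α)) = x ^ p * x / (T ^ 2 * (x ^ α) ^ 2) := by
    have e1 : T ^ ((p - 1 - 4 * α) / (1 + α)) = x ^ (p - 1 - 4 * α) := by
      rw [hx, ← Real.rpow_mul hT0.le]
      congr 1
      ring
    have e2 : (x ^ α) ^ 4 = x ^ (4 * α) := by
      rw [← Real.rpow_natCast, ← Real.rpow_mul hx0.le]
      congr 1
      push_cast
      ring
    rw [e1, Real.rpow_sub hx0, Real.rpow_sub hx0, Real.rpow_one, ← e2, ← hxT]
    field_simp
  calc (1 / 2) ^ p * (1 / 2) / C₁ ^ 2 * T ^ ((p - 1 - 4 * α) / (1 + α))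
      = (1 / 2 * x) ^ p * (1 / 2 * x)
        / (T ^ 2 * ((2 + W) * (2 * C₀ * Real.exp (8 * C₀) * x ^ α)) ^ 2) := by
        rw [hγ, Real.mul_rpow (by norm_num) hx0.le, hC₁]
        field_simp
    _ ≤ (N : ℝ) ^ p * N
        / (T ^ 2 * ((2 + W) * (2 * C₀ * Real.exp (8 * C₀) * x ^ α)) ^ 2) := by gcongr

end PowerLaw

end GenFib

namespace GenFib

/-! ### Words of the subshift and their transfer matrices -/

section Substitution

theorem substWord_append (S : Letter → List Letter) (v w : List Letter) :
    substWord S (v ++ w) = substWord S v ++ substWord S w := List.flatMap_append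

theorem substWord_iterate_append (S : Letter → List Letter) (k : ℕ) (v w : List Letter) :
    (substWord S)^[k] (v ++ w) = (substWord S)^[k] v ++ (substWord S)^[k] w := by
  induction k generalizing v w with
  | zero => rfl
  | succ k ih => simp only [Function.iterate_succ_apply, substWord_append, ih]

theorem substWord_ne_nil {S : Letter → List Letter} (hS : ∀ x, S x ≠ []) {w : List Letter}
    (hw : w ≠ []) : substWord S w ≠ [] := by
  obtain ⟨x, w, rfl⟩ := List.exists_cons_of_ne_nil hw
  simp [substWord, hS x]

theorem substWord_iterate_ne_nil {S : Letter → List Letter} (hS : ∀ x, S x ≠ []) (k : ℕ)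
    {w : List Letter} (hw : w ≠ []) : (substWord S)^[k] w ≠ [] := by
  induction k with
  | zero => exact hw
  | succ k ih =>
    rw [Function.iterate_succ_apply']
    exact substWord_ne_nil hS ih

theorem exists_substWord_iterate_succ {S : Letter → List Letter} (hS : ∀ x, S x ≠ [])
    {s : List Letter} (hs : s ≠ []) (hSa : S Letter.a = Letter.a :: s) (k : ℕ) :
    ∃ t, t ≠ [] ∧ (substWord S)^[k + 1] [Letter.a] = (substWord S)^[k] [Letter.a] ++ t := by
  refine ⟨(substWord S)^[k] s, substWord_iterate_ne_nil hS k hs, ?_⟩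
  rw [← substWord_iterate_append, Function.iterate_succ_apply]
  simp [substWord, hSa]

theorem lt_length_substWord_iterate {S : Letter → List Letter} (hS : ∀ x, S x ≠ [])
    {s : List Letter} (hs : s ≠ []) (hSa : S Letter.a = Letter.a :: s) (k : ℕ) :
    k < ((substWord S)^[k] [Letter.a]).length := by
  induction k with
  | zero => simp
  | succ k ih =>
    obtain ⟨t, ht, e⟩ := exists_substWord_iterate_succ hS hs hSa k
    have := List.length_pos_of_ne_nil ht
    rw [e, List.length_append]
    omega

/-- The words `S^k(a)` are successive prefixes, so the limit sequence may be read off from any late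
enough iterate. -/
theorem substSeq_eq_getElem {S : Letter → List Letter} (hS : ∀ x, S x ≠ [])
    {s : List Letter} (hs : s ≠ []) (hSa : S Letter.a = Letter.a :: s) {i K : ℕ} (hi : i ≤ K)
    (hl : i < ((substWord S)^[K] [Letter.a]).length) :
    substSeq S i = ((substWord S)^[K] [Letter.a])[i] := by
  induction K, hi using Nat.le_induction with
  | base => exact List.getD_eq_getElem _ _ hl
  | succ K hK ih =>
    obtain ⟨t, -, e⟩ := exists_substWord_iterate_succ hS hs hSa K
    have hl' := hK.trans_lt (lt_length_substWord_iterate hS hs hSa K)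
    simp only [e]
    rw [ih hl', List.getElem_append_left hl']

/-- Desubstitution: a window occurs in some iterate of `S` on `a`, and peeling off the outermost `S`
exhibits it as a factor of a concatenation of blocks. Nothing else about the subshift is needed. -/
theorem window_eq_take_drop {S : Letter → List Letter} (hS : ∀ x, S x ≠ [])
    {s : List Letter} (hs : s ≠ []) (hSa : S Letter.a = Letter.a :: s) {ω : ℤ → Letter}
    (hω : ω ∈ subshift S) (i : ℤ) (L : ℕ) :
    ∃ v : List Letter, ∃ j : ℕ, window ω i L = ((substWord S v).drop j).take L := by
  obtain ⟨j, hj⟩ := hω i L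
  refine ⟨(substWord S)^[j + L] [Letter.a], j, ?_⟩
  rw [← Function.iterate_succ_apply' (substWord S)]
  have hlen := lt_length_substWord_iterate hS hs hSa (j + L + 1)
  rw [window_eq_map_range]
  refine List.ext_getElem ?_ fun k h1 h2 => ?_
  · simp only [List.length_map, List.length_range, List.length_take, List.length_drop,
      Nat.succ_eq_add_one]
    omega
  · simp only [List.length_map, List.length_range] at h1
    simp only [List.getElem_map, List.getElem_range, List.getElem_take, List.getElem_drop]
    rw [hj k h1, substSeq_eq_getElem hS hs hSa (K := j + L + 1) (by omega)]

theorem genFib_ne_nil {m n : ℕ} (hm : 1 ≤ m) (x : Letter) : genFib m n x ≠ [] := by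
  cases x
  · simp [genFib]
    omega
  · simp [genFib]

theorem genFib_a {m n : ℕ} (hm : 1 ≤ m) : genFib m n Letter.a
    = Letter.a :: (List.replicate (m - 1) Letter.a ++ List.replicate n Letter.b) := by
  obtain ⟨k, rfl⟩ := Nat.exists_eq_add_of_le' hm
  simp [genFib, List.replicate_succ]

/-- The number of letters `a` in a word. -/
def countA (w : List Letter) : ℕ := w.countP fun | Letter.a => true | Letter.b => false

theorem countA_append (v w : List Letter) : countA (v ++ w) = countA v + countA w :=
  List.countP_append

theorem countA_le_length (w : List Letter) : countA w ≤ w.length := List.countP_le_length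

theorem countA_replicate_a (k : ℕ) : countA (List.replicate k Letter.a) = k := by
  simp [countA, List.countP_replicate]

theorem countA_replicate_b (k : ℕ) : countA (List.replicate k Letter.b) = 0 := by
  simp [countA, List.countP_replicate]

section Products

variable {M : Letter → Matrix (Fin 2) (Fin 2) ℝ} {s : ℝ} {m n : ℕ}

theorem wordProd_take_genFib (x : Letter) (k : ℕ) :
    ∃ r ≤ n, wordProd M ((genFib m n x).take k)
      = M Letter.b ^ r * M Letter.a ^ countA ((genFib m n x).take k) := by
  cases x
  · refine ⟨min (k - m) n, min_le_right _ _, ?_⟩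
    simp [genFib, List.take_append, List.take_replicate, wordProd_append, wordProd_replicate,
      countA_append, countA_replicate_a, countA_replicate_b]
  · refine ⟨0, Nat.zero_le _, ?_⟩
    have : (genFib m n Letter.b).take k = List.replicate (min k 1) Letter.a := by
      rw [← List.take_replicate]
      rfl
    simp [this, wordProd_replicate, countA_replicate_a]

theorem wordProd_genFib (hs : s = 1 ∨ s = -1) (hB : M Letter.b ^ n = s • 1) (x : Letter) :
    ∃ σ : ℝ, (σ = 1 ∨ σ = -1) ∧
      wordProd M (genFib m n x) = σ • M Letter.a ^ countA (genFib m n x) := by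
  cases x
  · refine ⟨s, hs, ?_⟩
    simp [genFib, wordProd_append, wordProd_replicate, countA_append, countA_replicate_a,
      countA_replicate_b, hB]
  · refine ⟨1, Or.inl rfl, ?_⟩
    simp [genFib, countA]

/-- Complete blocks contribute only signs and powers of `M a`, which commute; the power of `M b`
comes from the last, truncated block. -/
theorem wordProd_take_substWord (hs : s = 1 ∨ s = -1) (hB : M Letter.b ^ n = s • 1)
    (v : List Letter) (k : ℕ) :
    ∃ r ≤ n, ∃ σ : ℝ, (σ = 1 ∨ σ = -1) ∧ wordProd M ((substWord (genFib m n) v).take k)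
      = σ • (M Letter.b ^ r * M Letter.a ^ countA ((substWord (genFib m n) v).take k)) := by
  induction v generalizing k with
  | nil => exact ⟨0, Nat.zero_le _, 1, Or.inl rfl, by simp [substWord, countA]⟩
  | cons x v ih =>
    have e : substWord (genFib m n) (x :: v) = genFib m n x ++ substWord (genFib m n) v := rfl
    rw [e, List.take_append]
    rcases le_total k (genFib m n x).length with hk | hk
    · obtain ⟨r, hr, h⟩ := wordProd_take_genFib (M := M) (m := m) (n := n) x k
      refine ⟨r, hr, 1, Or.inl rfl, ?_⟩
      rw [Nat.sub_eq_zero_of_le hk, List.take_zero, List.append_nil, one_smul, h]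
    · obtain ⟨r, hr, σ, hσ, h⟩ := ih (k - (genFib m n x).length)
      obtain ⟨τ, hτ, h'⟩ := wordProd_genFib (m := m) hs hB x
      refine ⟨r, hr, σ * τ, ?_, ?_⟩
      · rcases hσ with rfl | rfl <;> rcases hτ with rfl | rfl <;> simp
      · rw [List.take_of_length_le hk, wordProd_append, countA_append, h, h', pow_add,
          smul_mul_smul_comm, mul_assoc, (Commute.pow_pow_self (M Letter.a) _ _).eq]

/-- The product along a subword is, up to sign, a power of `M a` between boundary terms. -/
theorem wordProd_take_drop_substWord (hs : s = 1 ∨ s = -1) (hB : M Letter.b ^ n = s • 1)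
    (hdet : ∀ x, (M x).det = 1) (v : List Letter) (j L : ℕ) :
    ∃ r ≤ n, ∃ r' ≤ n, ∃ d ≤ L, ∃ σ : ℝ, (σ = 1 ∨ σ = -1) ∧
      wordProd M (((substWord (genFib m n) v).drop j).take L)
        = σ • (M Letter.b ^ r * M Letter.a ^ d * (M Letter.b ^ r').adjugate) := by
  set w := substWord (genFib m n) v with hw
  -- A factor is the quotient of two prefixes. The powers of `M a` cancel up to the number of
  -- letters `a` in the factor, and adjugates serve as inverses since determinants are 1.
  obtain ⟨r, hr, σ, hσ, h⟩ := wordProd_take_substWord (m := m) hs hB v (j + L)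
  obtain ⟨r', hr', τ, hτ, h'⟩ := wordProd_take_substWord (m := m) hs hB v j
  rw [← hw] at h h'
  refine ⟨r, hr, r', hr', countA ((w.drop j).take L),
    (countA_le_length _).trans (List.length_take_le _ _), σ * τ, ?_, ?_⟩
  · rcases hσ with rfl | rfl <;> rcases hτ with rfl | rfl <;> simp
  have hAd : ∀ c, M Letter.a ^ c * (M Letter.a ^ c).adjugate = 1 := fun c => by
    rw [Matrix.mul_adjugate, Matrix.det_pow, hdet, one_pow, one_smul]
  have hBd : M Letter.b ^ r' * (M Letter.b ^ r').adjugate = 1 := by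
    rw [Matrix.mul_adjugate, Matrix.det_pow, hdet, one_pow, one_smul]
  have hττ : τ * τ = 1 := by rcases hτ with rfl | rfl <;> simp
  set c := countA (w.take j) with hc
  have hinv : wordProd M (w.take j)
      * (τ • ((M Letter.a ^ c).adjugate * (M Letter.b ^ r').adjugate)) = 1 := by
    rw [h', smul_mul_smul_comm, hττ, one_smul, mul_assoc, ← mul_assoc (M Letter.a ^ c), hAd,
      one_mul, hBd]
  rw [List.take_add, wordProd_append, countA_append, ← hc] at h
  calc wordProd M ((w.drop j).take L)
      = wordProd M ((w.drop j).take L) * (wordProd M (w.take j)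
        * (τ • ((M Letter.a ^ c).adjugate * (M Letter.b ^ r').adjugate))) := by
        rw [hinv, mul_one]
    _ = _ := by
        rw [← mul_assoc, h, smul_mul_smul_comm, add_comm c, pow_add]
        simp only [mul_assoc]
        rw [← mul_assoc (M Letter.a ^ c), hAd, one_mul]

end Products

end Substitution

/-! ### Powers of elliptic and parabolic one-step matrices -/

section Powers

open Matrix

theorem EntriesLE.sign_smul {K σ : ℝ} {M : Matrix (Fin 2) (Fin 2) ℝ} (h : EntriesLE K M)
    (hσ : σ = 1 ∨ σ = -1) : EntriesLE K (σ • M) := by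
  rcases hσ with rfl | rfl
  · rwa [one_smul]
  · rw [neg_one_smul]
    exact h.neg

theorem exists_entriesLE_pow_of_le (B : Matrix (Fin 2) (Fin 2) ℝ) (n : ℕ) :
    ∃ K : ℝ, ∀ r ≤ n, EntriesLE K (B ^ r) := by
  refine ⟨∑ r ∈ Finset.range (n + 1), ∑ i, ∑ j, |(B ^ r) i j|, fun r hr i j => ?_⟩
  calc |(B ^ r) i j| ≤ ∑ j, |(B ^ r) i j| :=
        Finset.single_le_sum (f := fun j => |(B ^ r) i j|) (fun _ _ => abs_nonneg _)
          (Finset.mem_univ j)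
    _ ≤ ∑ i, ∑ j, |(B ^ r) i j| :=
        Finset.single_le_sum (f := fun i => ∑ j, |(B ^ r) i j|)
          (fun _ _ => Finset.sum_nonneg fun _ _ => abs_nonneg _) (Finset.mem_univ i)
    _ ≤ _ :=
        Finset.single_le_sum (f := fun r => ∑ i, ∑ j, |(B ^ r) i j|)
          (fun _ _ => Finset.sum_nonneg fun _ _ => Finset.sum_nonneg fun _ _ => abs_nonneg _)
          (Finset.mem_range.2 (Nat.lt_succ_of_le hr))

/-- The transfer matrix preserves the form `u² - y u v + v²`, `y = E - x`, which is positive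
definite for `|y| < 2`; the columns of all powers lie on one ellipse. -/
theorem exists_entriesLE_transfer_pow_of_elliptic {x E : ℝ} (h : |x - E| < 2) :
    ∃ C : ℝ, ∀ k : ℕ, EntriesLE C (transfer x E ^ k) := by
  set y := E - x with hy
  have hy2 : |y| < 2 := by rwa [hy, abs_sub_comm]
  have inv : ∀ (k : ℕ) (j : Fin 2), (transfer x E ^ k) 0 j ^ 2
      - y * ((transfer x E ^ k) 0 j * (transfer x E ^ k) 1 j) + (transfer x E ^ k) 1 j ^ 2 = 1 := by
    intro k j
    induction k with
    | zero => fin_cases j <;> simp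
    | succ k ih =>
      have e0 : (transfer x E ^ (k + 1)) 0 j
          = y * (transfer x E ^ k) 0 j - (transfer x E ^ k) 1 j := by
        rw [pow_succ', Matrix.mul_apply, Fin.sum_univ_two]
        simp [transfer, hy]
        ring
      have e1 : (transfer x E ^ (k + 1)) 1 j = (transfer x E ^ k) 0 j := by
        rw [pow_succ', Matrix.mul_apply, Fin.sum_univ_two]
        simp [transfer]
      rw [e0, e1, ← ih]
      ring
  -- The smallest eigenvalue of the form. The bound `1/√δ` is relaxed to `1/δ`, using `δ ≤ 1`.
  set δ := 1 - |y| / 2 with hδ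
  have hδ0 : 0 < δ := by linarith
  have hδ1 : δ ≤ 1 := by linarith [abs_nonneg y]
  have bound : ∀ u v : ℝ, u ^ 2 - y * (u * v) + v ^ 2 = 1 → |u| ≤ 1 / δ ∧ |v| ≤ 1 / δ := by
    intro u v huv
    have h1 : y * (u * v) ≤ |y| * (|u| * |v|) := by
      rw [← abs_mul, ← abs_mul]
      exact le_abs_self _
    have h2 : |y| * (|u| * |v|) ≤ |y| * ((u ^ 2 + v ^ 2) / 2) := by
      refine mul_le_mul_of_nonneg_left ?_ (abs_nonneg _)
      nlinarith [sq_nonneg (|u| - |v|), sq_abs u, sq_abs v]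
    have h3 : δ * (u ^ 2 + v ^ 2) ≤ 1 := by
      rw [hδ]
      linarith
    have h4 : u ^ 2 + v ^ 2 ≤ (1 / δ) ^ 2 := by
      have e : u ^ 2 + v ^ 2 ≤ 1 / δ := by
        rw [le_div_iff₀ hδ0]
        linarith
      have : 1 ≤ 1 / δ := by rwa [le_div_iff₀ hδ0, one_mul]
      nlinarith
    have hp : 0 ≤ 1 / δ := by positivity
    exact ⟨abs_le_of_sq_le_sq (by linarith [sq_nonneg v]) hp,
      abs_le_of_sq_le_sq (by linarith [sq_nonneg u]) hp⟩
  refine ⟨1 / δ, fun k i j => ?_⟩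
  have hb := bound _ _ (inv k j)
  fin_cases i
  · exact hb.1
  · exact hb.2

/-- Here `T = s(I + N)` with `s = ±1` and `N² = 0`, so `T^k = s^k (I + kN)` grows linearly. -/
theorem exists_entriesLE_transfer_pow_of_parabolic {x E : ℝ} (h : |x - E| = 2) :
    ∃ C : ℝ, ∀ k : ℕ, EntriesLE (C * ((k : ℝ) + 1)) (transfer x E ^ k) := by
  obtain ⟨s, hs, hE⟩ : ∃ s : ℝ, (s = 1 ∨ s = -1) ∧ E = x + 2 * s := by
    rcases (abs_eq (by norm_num : (0 : ℝ) ≤ 2)).1 h with h | h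
    · exact ⟨-1, Or.inr rfl, by linarith⟩
    · exact ⟨1, Or.inl rfl, by linarith⟩
  have hs2 : s * s = 1 := by rcases hs with rfl | rfl <;> norm_num
  have hpow : ∀ k : ℕ, transfer x E ^ k
      = s ^ k • !![(k : ℝ) + 1, -s * k; s * k, 1 - k] := by
    intro k
    induction k with
    | zero => ext i j; fin_cases i <;> fin_cases j <;> simp
    | succ k ih =>
      rw [pow_succ', ih, hE]
      ext i j
      fin_cases i <;> fin_cases j <;>
        simp [transfer, Matrix.mul_apply, Fin.sum_univ_two, pow_succ] <;>
        first
          | ring1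
          | linear_combination (s ^ k * (1 - (k : ℝ))) * hs2
          | linear_combination (-(s ^ k * (1 + (k : ℝ)))) * hs2
  refine ⟨1, fun k => ?_⟩
  have hsk : s ^ k = 1 ∨ s ^ k = -1 := by
    rcases hs with rfl | rfl
    · left; simp
    · exact neg_one_pow_eq_or ℝ k
  have hk : (0 : ℝ) ≤ k := Nat.cast_nonneg k
  rw [hpow, one_mul]
  refine EntriesLE.sign_smul (fun i j => ?_) hsk
  have hsabs : |s| = 1 := by rcases hs with rfl | rfl <;> simp
  have h1 : |s * k| ≤ (k : ℝ) + 1 := by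
    rw [abs_mul, hsabs, one_mul, abs_of_nonneg hk]
    linarith
  fin_cases i <;> fin_cases j
  · exact (abs_of_nonneg (by simp; positivity)).le
  · simpa using h1
  · simpa using h1
  · exact abs_le.2 ⟨by simp, by simp; linarith⟩

end Powers

end GenFib

/-! ### Generalized Fibonacci Hamiltonians at an energy where `b^n` is trivial -/

namespace GenFib

/-- The boundary factors are among finitely many powers of `T(b,E)`, so they change only the
constant, uniformly in `ω` and in the window. -/
theorem exists_entriesLE_window {a b E s α C : ℝ} {m n : ℕ} (hm : 1 ≤ m) (hn : 1 ≤ n) (hα : 0 ≤ α)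
    (hs : s = 1 ∨ s = -1) (hB : transfer b E ^ n = s • 1)
    (hA : ∀ k : ℕ, EntriesLE (C * ((k : ℝ) + 1) ^ α) (transfer a E ^ k)) :
    ∃ C' : ℝ, ∀ ω ∈ subshift (genFib m n), ∀ (i : ℤ) (L : ℕ),
      EntriesLE (C' * ((L : ℝ) + 1) ^ α)
        (wordProd (fun x => transfer x E) (window (potential a b ω) i L)) := by
  obtain ⟨K, hK⟩ := exists_entriesLE_pow_of_le (transfer b E) n
  refine ⟨2 * (2 * K * C) * K, fun ω hω i L => ?_⟩
  have hC : 0 ≤ C := by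
    have h := (abs_nonneg _).trans (hA 0 0 0)
    simpa using h
  have hK0 : 0 ≤ K := (abs_nonneg _).trans (hK 0 (Nat.zero_le _) 0 0)
  obtain ⟨v, j, hv⟩ := window_eq_take_drop (genFib_ne_nil hm)
    (by simp; omega) (genFib_a hm) hω i L
  have e : window (potential a b ω) i L = (window ω i L).map (letterVal a b) :=
    window_map (letterVal a b) ω i L
  obtain ⟨r, hr, r', hr', d, hd, σ, hσ, h⟩ :=
    wordProd_take_drop_substWord (M := fun x => transfer (letterVal a b x) E) (m := m) hs hB
      (fun x => det_transfer _ _) v j L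
  rw [e, wordProd_map, hv, h]
  refine EntriesLE.sign_smul (EntriesLE.mono (((hK r hr).mul (hA d)).mul (hK r' hr').adjugate) ?_)
    hσ
  have : ((d : ℝ) + 1) ^ α ≤ ((L : ℝ) + 1) ^ α := by gcongr
  calc 2 * (2 * K * (C * ((d : ℝ) + 1) ^ α)) * K = 2 * (2 * K * C) * K * ((d : ℝ) + 1) ^ α := by ring
    _ ≤ 2 * (2 * K * C) * K * ((L : ℝ) + 1) ^ α := by gcongr

/-- Lower bounds on the transport exponents of generalized Fibonacci Hamiltonians, from an energy
at which the block `b ^ n` is trivial. -/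
theorem betaMinus_hamiltonian_ge {a b E s : ℝ} {m n : ℕ} (hm : 1 ≤ m) (hn : 1 ≤ n)
    (hs : s = 1 ∨ s = -1) (hB : transfer b E ^ n = s • 1) {ω : ℤ → Letter}
    (hω : ω ∈ subshift (genFib m n)) :
    (|a - E| < 2 → ∀ p : ℝ, 0 < p →
      ((p - 1 : ℝ) : EReal) ≤ betaMinus (hamiltonian a b ω) (delta 1) p) ∧
    (|a - E| = 2 → ∀ p : ℝ, 0 < p →
      (((p - 5) / 2 : ℝ) : EReal) ≤ betaMinus (hamiltonian a b ω) (delta 1) p) := by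
  refine ⟨fun h p hp => ?_, fun h p hp => ?_⟩
  · obtain ⟨C, hC⟩ := exists_entriesLE_transfer_pow_of_elliptic h
    obtain ⟨C', hC'⟩ := exists_entriesLE_window (C := C) hm hn le_rfl hs hB
      (fun k => by simpa using hC k)
    have := betaMinus_ge_of_transfer_power_law (potential_bounded a b ω) le_rfl (hC' ω hω) hp
    have e : (p - 1 - 4 * 0) / (1 + 0) = p - 1 := by ring
    rwa [e] at this
  · obtain ⟨C, hC⟩ := exists_entriesLE_transfer_pow_of_parabolic h
    obtain ⟨C', hC'⟩ := exists_entriesLE_window (C := C) hm hn zero_le_one hs hB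
      (fun k => by simpa using hC k)
    have := betaMinus_ge_of_transfer_power_law (potential_bounded a b ω) zero_le_one (hC' ω hω) hp
    have e : (p - 1 - 4 * 1) / (1 + 1) = (p - 5) / 2 := by ring
    rwa [e] at this

/-! ### Energies with `T(b,E)^n = ±I` -/

section Chebyshev

open Polynomial Polynomial.Chebyshev

/-- Cayley–Hamilton, `T² = (E - b) T - I`, is the recurrence of the `U_k` at `(E - b)/2`. The index
`k - 1` is an integer, with `U_(-1) = 0` at `k = 0`. -/
theorem transfer_pow_succ (b E : ℝ) (k : ℕ) :
    transfer b E ^ (k + 1) = (U ℝ k).eval ((E - b) / 2) • transfer b E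
      - (U ℝ (k - 1)).eval ((E - b) / 2) • 1 := by
  induction k with
  | zero => simp
  | succ k ih =>
    have hU : U ℝ ((k + 1 : ℕ) : ℤ) = 2 * X * U ℝ k - U ℝ (k - 1) := by
      have := U_add_two ℝ ((k : ℤ) - 1)
      rw [show (k : ℤ) - 1 + 2 = ((k + 1 : ℕ) : ℤ) by push_cast; ring,
        show (k : ℤ) - 1 + 1 = k by ring] at this
      exact this
    have hsq : transfer b E * transfer b E = (E - b) • transfer b E - 1 := by
      ext i j; fin_cases i <;> fin_cases j <;> simp [transfer]; ring
    rw [pow_succ, ih, sub_mul, smul_mul_assoc, hsq, smul_mul_assoc, one_mul, hU,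
      show ((k + 1 : ℕ) : ℤ) - 1 = k by push_cast; ring]
    simp only [eval_sub, eval_mul, eval_X, eval_ofNat]
    ext i j
    simp only [Matrix.sub_apply, Matrix.smul_apply, smul_eq_mul]
    ring

/-- The lower left entry of the power is `U_k`. If it vanishes the power is scalar, and determinant
1 forces the scalar to be `±1`. -/
theorem transfer_pow_succ_eq_one_or_neg_one_iff (b E : ℝ) (k : ℕ) :
    (transfer b E ^ (k + 1) = 1 ∨ transfer b E ^ (k + 1) = -1)
      ↔ (U ℝ k).eval ((E - b) / 2) = 0 := by
  have h10 : (transfer b E ^ (k + 1)) 1 0 = (U ℝ k).eval ((E - b) / 2) := by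
    rw [transfer_pow_succ]
    simp [transfer]
  constructor
  · rintro (h | h) <;> rw [h] at h10 <;> simpa using h10.symm
  · intro h
    have e := transfer_pow_succ b E k
    rw [h, zero_smul, zero_sub] at e
    set u := (U ℝ (k - 1)).eval ((E - b) / 2)
    have hd := congrArg Matrix.det e
    rw [Matrix.det_pow, det_transfer, one_pow, ← neg_smul, Matrix.det_smul, Matrix.det_one,
      Fintype.card_fin, mul_one, neg_sq] at hd
    rcases sq_eq_sq_iff_eq_or_eq_neg.1 (hd.symm.trans (one_pow 2).symm) with hu | hu
    · right; rw [e, hu, one_smul]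
    · left; rw [e, hu, neg_one_smul, neg_neg]

/-- `U_k` has `k` distinct real roots, carried to the energies by `y ↦ 2y + b`. -/
theorem ncard_transfer_pow_succ (b : ℝ) (k : ℕ) :
    {E : ℝ | transfer b E ^ (k + 1) = 1 ∨ transfer b E ^ (k + 1) = -1}.ncard = k := by
  have hU : U ℝ k ≠ 0 := by
    intro h
    have := degree_U_natCast ℝ k
    rw [h, degree_zero] at this
    exact absurd this (by simp)
  have e : {E : ℝ | transfer b E ^ (k + 1) = 1 ∨ transfer b E ^ (k + 1) = -1}
      = (fun y => 2 * y + b) '' ((U ℝ k).roots.toFinset : Set ℝ) := by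
    ext E
    simp only [Set.mem_ofPred_eq, transfer_pow_succ_eq_one_or_neg_one_iff, Set.mem_image,
      Finset.mem_coe, Multiset.mem_toFinset, mem_roots hU, IsRoot.def]
    constructor
    · exact fun h => ⟨(E - b) / 2, h, by ring⟩
    · rintro ⟨y, hy, rfl⟩
      rwa [show (2 * y + b - b) / 2 = y by ring]
  rw [e, Set.ncard_image_of_injective _ (fun x y h => by simpa using h), Set.ncard_coe_finset,
    roots_U_real, Finset.val_toFinset, Finset.card_image_of_injOn, Finset.card_range]
  exact (Finset.range k).nodup_map_iff_injOn.mp (roots_U_real_nodup k)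

end Chebyshev

theorem transfer_self_sq (b : ℝ) : transfer b b ^ 2 = -1 := by
  rw [sq]
  ext i j; fin_cases i <;> fin_cases j <;> simp [transfer]

end GenFib

theorem corollary4p5 (a b : ℝ) (m n : ℕ) (hm : 1 ≤ m) :
    (2 ≤ n → Even n → ∀ ω ∈ subshift (genFib m n),
      (|a - b| < 2 → ∀ p : ℝ, 0 < p →
        ((p - 1 : ℝ) : EReal) ≤ betaMinus (hamiltonian a b ω) (delta 1) p) ∧
      (|a - b| = 2 → ∀ p : ℝ, 0 < p →
        (((p - 5) / 2 : ℝ) : EReal) ≤ betaMinus (hamiltonian a b ω) (delta 1) p)) ∧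
    (3 ≤ n → Odd n →
      {E₀ : ℝ | transfer b E₀ ^ n = 1 ∨ transfer b E₀ ^ n = -1}.ncard = n - 1 ∧
      ∀ E₀ : ℝ, (transfer b E₀ ^ n = 1 ∨ transfer b E₀ ^ n = -1) →
        ∀ ω ∈ subshift (genFib m n),
          (|a - E₀| < 2 → ∀ p : ℝ, 0 < p →
            ((p - 1 : ℝ) : EReal) ≤ betaMinus (hamiltonian a b ω) (delta 1) p) ∧
          (|a - E₀| = 2 → ∀ p : ℝ, 0 < p →
            (((p - 5) / 2 : ℝ) : EReal) ≤ betaMinus (hamiltonian a b ω) (delta 1) p)) := by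
  refine ⟨fun h2 hn ω hω => ?_, fun h3 _ => ⟨?_, fun E₀ hE ω hω => ?_⟩⟩
  · obtain ⟨k, rfl⟩ := hn
    -- The energy is `E = b` and the sign is `(-1)^k`, because `T(b,b)^(2k) = (-I)^k`.
    refine betaMinus_hamiltonian_ge hm (by omega) (neg_one_pow_eq_or ℝ k) ?_ hω
    rw [← two_mul, pow_mul, transfer_self_sq]
    rcases Nat.even_or_odd k with hk | hk <;> simp [hk.neg_one_pow]
  · obtain ⟨k, rfl⟩ := Nat.exists_eq_add_of_le' (show 1 ≤ n by omega)
    exact ncard_transfer_pow_succ b k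
  · rcases hE with h | h
    · exact betaMinus_hamiltonian_ge hm (by omega) (Or.inl rfl) (by rw [h, one_smul]) hω
    · exact betaMinus_hamiltonian_ge hm (by omega) (Or.inr rfl) (by rw [h, neg_one_smul]) hω
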